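/- Let $K$ be a field and $q\in K$ with $q\neq 0$. Let $\mathcal H_q$ be the $q$-deformed Heisenberg algebra over $K$, that is, the unital associative $K$-algebra generated by two elements $A,B$ subject to the single relation $AB-qBA=1$, and let $Z(\mathcal H_q)$ be its center. (1) If $P,Q\in\mathcal H_q$ commute, then there is a nonzero bivariate polynomial $F(x,y)=\sum c_{ij}x^iy^j\in Z(\mathcal H_q)[x,y]$ such that $F(P,Q)=\sum c_{ij}P^iQ^j=0$. (2) Suppose that $q$ is of torsion type of order $p$, that is, either $q\neq 1$ is a root of unity and $p$ is the least positive integer with $q^p=1$, or $q=1$ and $K$ has characteristic $p>0$. Then: (a) $Z(\mathcal H_q)=K[A^p,B^p]$, the $K$-subalgebra of $\mathcal H_q$ generated by $A^p$ and $B^p$, and this ring is an integral domain; (b) the $p^2$ elements $B^iA^j$ with $0\le i,j<p$ are pairwise distinct and span $\mathcal H_q$ as a $Z(\mathcal H_q)$-module; (c) for all $\alpha,\beta\in\mathcal H_q$ (in particular for all commuting ones) the family of the $(p+1)^2$ products $\alpha^i\beta^j$, $0\le i,j\le p$, is linearly dependent over $Z(\mathcal H_q)$: there are $c_{ij}\in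 Z(\mathcal H_q)$, not all zero, with $\sum_{i=0}^p\sum_{j=0}^p c_{ij}\alpha^i\beta^j=0$. -/

import Mathlib

/-- The defining relation `A B - q B A = 1` on the free algebra on two generators, where
`0 : Fin 2` stands for `A` and `1 : Fin 2` for `B`. -/
inductive QHeisenberg.Rel (K : Type*) [Field K] (q : K) :
    FreeAlgebra K (Fin 2) → FreeAlgebra K (Fin 2) → Prop
  | comm : QHeisenberg.Rel K q
      (FreeAlgebra.ι K 0 * FreeAlgebra.ι K 1 - q • (FreeAlgebra.ι K 1 * FreeAlgebra.ι K 0)) 1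

/-- The `q`-deformed Heisenberg algebra over `K`: the unital associative `K`-algebra generated by
`A` and `B` subject to `A B - q B A = 1`. -/
abbrev QHeisenberg (K : Type*) [Field K] (q : K) : Type _ :=
  RingQuot (QHeisenberg.Rel K q)

/-- The generator `A`. -/
noncomputable def QHeisenberg.A {K : Type*} [Field K] (q : K) : QHeisenberg K q :=
  RingQuot.mkAlgHom K (QHeisenberg.Rel K q) (FreeAlgebra.ι K 0)

/-- The generator `B`. -/
noncomputable def QHeisenberg.B {K : Type*} [Field K] (q : K) : QHeisenberg K q :=
  RingQuot.mkAlgHom K (QHeisenberg.Rel K q) (FreeAlgebra.ι K 1)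

theorem QHeisenberg.A_mul_B_sub {K : Type*} [Field K] (q : K) :
    QHeisenberg.A q * QHeisenberg.B q - q • (QHeisenberg.B q * QHeisenberg.A q) = 1 := by
  have h := RingQuot.mkAlgHom_rel K (QHeisenberg.Rel.comm (K := K) (q := q))
  simpa only [map_sub, map_mul, map_smul, map_one, QHeisenberg.A, QHeisenberg.B] using h

open Classical in
/-- The order of `q`. For `q ≠ 1` it is the least positive `p` with `q ^ p = 1`, and `0` if there
is no such `p`; for `q = 1` it is the characteristic of `K`. In both cases it is the least positive
`p` with `1 + q + ⋯ + q ^ (p - 1) = 0`, or `0` if there is none. The element `q` is of torsion type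
if its order is positive, and of free type if its order is `0`. -/
noncomputable def QHeisenberg.order {K : Type*} [Field K] (q : K) : ℕ :=
  if q = 1 then ringChar K else orderOf q

/-- The value `F(P, Q) = ∑ c_{ij} P ^ i Q ^ j` of a bivariate polynomial `F = ∑ c_{ij} x ^ i y ^ j`
whose coefficients lie in the center of `R`. -/
noncomputable def evalCentral {K R : Type*} [Field K] [Ring R] [Algebra K R]
    (F : MvPolynomial (Fin 2) (Subalgebra.center K R)) (P Q : R) : R :=
  ∑ m ∈ F.support, ((MvPolynomial.coeff m F : Subalgebra.center K R) : R) * (P ^ m 0 * Q ^ m 1)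

/-! The monomials `B ^ i * A ^ j` form a basis. Since `A B = q B A + 1`, reordering a product of
monomials with exponents `m` and `m'` only yields exponents `m + m' - (r, r)`, and the coefficient
for `r = 0` is `q ^ (m.2 * m'.1)`. Hence lexicographically leading exponents add, and there are no
zero divisors.

In free type, commuting elements have proportional leading exponents (`ray_of_commute`): the top
coefficients decide this when `q ≠ 1`, and the next diagonal coefficient of the commutator when `q =
1`. So elements of degree at most `n` commuting with a nonconstant `P` span at most `n + 1`
dimensions, whereas the number of products `P ^ i * Q ^ j` grows quadratically. Thus a dependence
exists already over `K`.

In torsion type the `q`-number of `n` vanishes exactly when `p ∣ n`. This makes `A ^ p` and `B ^ p`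
central and forces every exponent of a central element to be divisible by `p`. The algebra is then
spanned over its center by `p ^ 2` monomials, too few for `(p + 1) ^ 2` independent products. -/

namespace QHeisenberg

variable {K : Type*} [Field K] {q : K}

/-- The `q`-number `1 + q + ⋯ + q ^ (n - 1)`. -/
def qNumber (q : K) (n : ℕ) : K := ∑ i ∈ Finset.range n, q ^ i

@[simp] theorem qNumber_zero (q : K) : qNumber q 0 = 0 := by simp [qNumber]

@[simp] theorem qNumber_one (q : K) : qNumber q 1 = 1 := by simp [qNumber]

theorem qNumber_succ (q : K) (n : ℕ) : qNumber q (n + 1) = q * qNumber q n + 1 :=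
  geom_sum_succ

theorem qNumber_succ' (q : K) (n : ℕ) : qNumber q (n + 1) = q ^ n + qNumber q n :=
  geom_sum_succ'

theorem mul_qNumber (q : K) (n : ℕ) : (q - 1) * qNumber q n = q ^ n - 1 :=
  mul_geom_sum q n

/-! ### Commutation relations for powers -/

theorem A_mul_B (q : K) : A q * B q = q • (B q * A q) + 1 := by
  rw [← A_mul_B_sub q]; abel

theorem A_mul_B_pow_succ (q : K) (n : ℕ) :
    A q * B q ^ (n + 1) = q ^ (n + 1) • (B q ^ (n + 1) * A q) + qNumber q (n + 1) • B q ^ n := by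
  induction n with
  | zero => simp [A_mul_B]
  | succ n ih =>
    rw [pow_succ (B q) (n + 1), ← mul_assoc, ih, add_mul, smul_mul_assoc, mul_assoc, A_mul_B,
      mul_add, mul_one, smul_mul_assoc, ← pow_succ, qNumber_succ' q (n + 1), mul_smul_comm,
      ← mul_assoc, smul_add, smul_smul, ← pow_succ, ← pow_succ, add_smul, add_assoc]

/-- The truncated exponent at `n = 0` is harmless because its coefficient `qNumber q 0` vanishes. -/
theorem A_mul_B_pow (q : K) (n : ℕ) :
    A q * B q ^ n = q ^ n • (B q ^ n * A q) + qNumber q n • B q ^ (n - 1) := by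
  cases n with
  | zero => simp
  | succ n => simpa using A_mul_B_pow_succ q n

theorem A_pow_mul_B (q : K) (n : ℕ) :
    A q ^ n * B q = q ^ n • (B q * A q ^ n) + qNumber q n • A q ^ (n - 1) := by
  induction n with
  | zero => simp
  | succ n ih =>
    have h : qNumber q n • (A q * A q ^ (n - 1)) = qNumber q n • A q ^ n := by
      cases n with
      | zero => simp
      | succ n => simp [pow_succ']
    rw [pow_succ' (A q) n, mul_assoc, ih, mul_add, mul_smul_comm, ← mul_assoc, A_mul_B, add_mul,
      one_mul, smul_mul_assoc, mul_assoc, smul_add, smul_smul, ← pow_succ, ← pow_succ',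
      mul_smul_comm, h, qNumber_succ', add_smul, add_assoc, Nat.add_sub_cancel]

/-! ### The monomial basis -/

/-- Left multiplication by `A` in the coordinates `(i, j) ↔ B ^ i * A ^ j`. -/
noncomputable def leftA (q : K) : Module.End K (ℕ × ℕ →₀ K) :=
  Finsupp.linearCombination K fun m =>
    q ^ m.1 • Finsupp.single (m.1, m.2 + 1) 1 + qNumber q m.1 • Finsupp.single (m.1 - 1, m.2) 1

/-- Left multiplication by `B` in the coordinates `(i, j) ↔ B ^ i * A ^ j`. -/
noncomputable def leftB (K : Type*) [Field K] : Module.End K (ℕ × ℕ →₀ K) :=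
  Finsupp.linearCombination K fun m => Finsupp.single (m.1 + 1, m.2) 1

theorem leftA_single (q : K) (m : ℕ × ℕ) : leftA q (Finsupp.single m 1) =
    q ^ m.1 • Finsupp.single (m.1, m.2 + 1) 1 + qNumber q m.1 • Finsupp.single (m.1 - 1, m.2) 1 := by
  simp [leftA]

theorem leftB_single (m : ℕ × ℕ) :
    leftB K (Finsupp.single m 1) = Finsupp.single (m.1 + 1, m.2) 1 := by
  simp [leftB]

theorem leftA_mul_leftB (q : K) : leftA q * leftB K - q • (leftB K * leftA q) = 1 := by
  ext1 m
  ext1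
  simp only [LinearMap.comp_apply, Finsupp.lsingle_apply, LinearMap.sub_apply,
    LinearMap.smul_apply, Module.End.mul_apply, leftB_single, leftA_single, map_add, map_smul,
    Module.End.one_apply]
  obtain ⟨i, j⟩ := m
  cases i with
  | zero => simp
  | succ i =>
    simp only [qNumber_succ q (i + 1), Nat.add_sub_cancel, add_smul, smul_add, smul_smul,
      ← pow_succ', one_smul]
    abel

/-- The representation of the `q`-deformed Heisenberg algebra by left multiplication. -/
noncomputable def leftRep (q : K) : QHeisenberg K q →ₐ[K] Module.End K (ℕ × ℕ →₀ K) :=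
  RingQuot.liftAlgHom K ⟨FreeAlgebra.lift K ![leftA q, leftB K], by
    rintro _ _ ⟨⟩
    simpa using leftA_mul_leftB q⟩

@[simp] theorem leftRep_A (q : K) : leftRep q (A q) = leftA q := by
  simp [leftRep, A]

@[simp] theorem leftRep_B (q : K) : leftRep q (B q) = leftB K := by
  simp [leftRep, B]

theorem leftB_pow_single (n : ℕ) (m : ℕ × ℕ) :
    (leftB K ^ n) (Finsupp.single m 1) = Finsupp.single (m.1 + n, m.2) 1 := by
  induction n with
  | zero => simp
  | succ n ih => rw [pow_succ', Module.End.mul_apply, ih, leftB_single, add_assoc]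

theorem leftA_pow_single (q : K) (n : ℕ) :
    (leftA q ^ n) (Finsupp.single (0, 0) 1) = Finsupp.single (0, n) 1 := by
  induction n with
  | zero => simp
  | succ n ih => rw [pow_succ', Module.End.mul_apply, ih, leftA_single]; simp

/-- Evaluating at the vector of index `(0, 0)` separates the monomials, so no relation among them
can hold in the algebra. -/
theorem leftRep_monomial (q : K) (m : ℕ × ℕ) :
    leftRep q (B q ^ m.1 * A q ^ m.2) (Finsupp.single (0, 0) 1) = Finsupp.single m 1 := by
  simp [leftA_pow_single, leftB_pow_single]

theorem linearIndependent_monomials (q : K) :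
    LinearIndependent K fun m : ℕ × ℕ => B q ^ m.1 * A q ^ m.2 := by
  refine LinearIndependent.of_comp
    ((LinearMap.applyₗ (Finsupp.single (0, 0) 1)).comp (leftRep q).toLinearMap) ?_
  convert (Finsupp.basisSingleOne (R := K) (ι := ℕ × ℕ)).linearIndependent using 1
  ext1 m
  simpa using leftRep_monomial q m

/-- An induction principle: a submodule which contains `1` and is stable under left multiplication
by the generators is everything. -/
theorem submodule_eq_top {S : Submodule K (QHeisenberg K q)} (h1 : 1 ∈ S)
    (hA : ∀ x ∈ S, A q * x ∈ S) (hB : ∀ x ∈ S, B q * x ∈ S) : S = ⊤ := by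
  have key : ∀ f : FreeAlgebra K (Fin 2), ∀ x ∈ S,
      RingQuot.mkAlgHom K (QHeisenberg.Rel K q) f * x ∈ S := by
    intro f
    induction f using FreeAlgebra.induction with
    | grade0 r =>
      intro x hx
      rw [AlgHom.commutes, ← Algebra.smul_def]
      exact S.smul_mem r hx
    | grade1 i =>
      fin_cases i
      · exact hA
      · exact hB
    | mul a b ha hb =>
      intro x hx
      rw [map_mul, mul_assoc]
      exact ha _ (hb x hx)
    | add a b ha hb =>
      intro x hx
      rw [map_add, add_mul]
      exact S.add_mem (ha x hx) (hb x hx)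
  rw [eq_top_iff]
  intro z _
  obtain ⟨f, rfl⟩ := RingQuot.mkAlgHom_surjective K (QHeisenberg.Rel K q) z
  simpa using key f 1 h1

theorem span_monomials (q : K) :
    Submodule.span K (Set.range fun m : ℕ × ℕ => B q ^ m.1 * A q ^ m.2) = ⊤ := by
  have hmem : ∀ i j : ℕ, B q ^ i * A q ^ j ∈
      Submodule.span K (Set.range fun m : ℕ × ℕ => B q ^ m.1 * A q ^ m.2) :=
    fun i j => Submodule.subset_span ⟨(i, j), rfl⟩
  apply submodule_eq_top
  · simpa using hmem 0 0
  · intro x hx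
    induction hx using Submodule.span_induction with
    | mem x hx =>
      obtain ⟨m, rfl⟩ := hx
      simp only
      rw [← mul_assoc, A_mul_B_pow, add_mul, smul_mul_assoc, smul_mul_assoc, mul_assoc,
        ← pow_succ']
      exact add_mem (Submodule.smul_mem _ _ (hmem _ _)) (Submodule.smul_mem _ _ (hmem _ _))
    | zero => simp
    | add x y _ _ hx hy => rw [mul_add]; exact add_mem hx hy
    | smul a x _ hx => rw [mul_smul_comm]; exact Submodule.smul_mem _ _ hx
  · intro x hx
    induction hx using Submodule.span_induction with
    | mem x hx =>
      obtain ⟨m, rfl⟩ := hx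
      simp only
      rw [← mul_assoc, ← pow_succ']
      exact hmem _ _
    | zero => simp
    | add x y _ _ hx hy => rw [mul_add]; exact add_mem hx hy
    | smul a x _ hx => rw [mul_smul_comm]; exact Submodule.smul_mem _ _ hx

/-- The Poincaré–Birkhoff–Witt basis `B ^ i * A ^ j`. -/
noncomputable def pbw (q : K) : Module.Basis (ℕ × ℕ) K (QHeisenberg K q) :=
  Module.Basis.mk (linearIndependent_monomials q) (span_monomials q).ge

theorem pbw_apply (q : K) (m : ℕ × ℕ) : pbw q m = B q ^ m.1 * A q ^ m.2 := by
  simp [pbw]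

theorem pbw_induction {p : QHeisenberg K q → Prop} (zero : p 0)
    (add : ∀ x y, p x → p y → p (x + y)) (smul : ∀ (c : K) x, p x → p (c • x))
    (mem : ∀ m, p (pbw q m)) (z : QHeisenberg K q) : p z := by
  have hz : z ∈ Submodule.span K (Set.range (pbw q)) := (pbw q).mem_span z
  induction hz using Submodule.span_induction with
  | mem x hx => obtain ⟨m, rfl⟩ := hx; exact mem m
  | zero => exact zero
  | add x y _ _ hx hy => exact add x y hx hy
  | smul c x _ hx => exact smul c x hx

/-! ### Coordinates of products -/

theorem pbw_repr_monomial (q : K) (i j : ℕ) :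
    (pbw q).repr (B q ^ i * A q ^ j) = Finsupp.single (i, j) 1 := by
  rw [← (pbw q).repr_self, pbw_apply]

theorem pbw_repr_A_mul (z : QHeisenberg K q) (i j : ℕ) :
    (pbw q).repr (A q * z) (i, j) =
      q ^ i * (if j = 0 then 0 else (pbw q).repr z (i, j - 1)) +
        qNumber q (i + 1) * (pbw q).repr z (i + 1, j) := by
  induction z using pbw_induction with
  | zero => simp
  | add x y hx hy =>
    simp only [mul_add, map_add, Finsupp.add_apply, hx, hy]
    split_ifs <;> ring
  | smul c x hx =>
    simp only [mul_smul_comm, map_smul, Finsupp.smul_apply, hx, smul_eq_mul]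
    split_ifs <;> ring
  | mem m =>
    obtain ⟨k, l⟩ := m
    rw [pbw_apply, ← mul_assoc, A_mul_B_pow, add_mul, smul_mul_assoc, smul_mul_assoc, mul_assoc,
      ← pow_succ', map_add, map_smul, map_smul]
    simp only [pbw_repr_monomial, Finsupp.add_apply, Finsupp.smul_apply, Finsupp.single_apply,
      Prod.mk.injEq, smul_eq_mul]
    congr 1
    · rcases j with - | j
      · simp
      · by_cases h : k = i <;> by_cases h' : l = j <;> simp [h, h']
    · rcases k with - | k
      · simp
      · by_cases h : k = i <;> by_cases h' : l = j <;> simp [h, h']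

theorem pbw_repr_mul_B (z : QHeisenberg K q) (i j : ℕ) :
    (pbw q).repr (z * B q) (i, j) =
      q ^ j * (if i = 0 then 0 else (pbw q).repr z (i - 1, j)) +
        qNumber q (j + 1) * (pbw q).repr z (i, j + 1) := by
  induction z using pbw_induction with
  | zero => simp
  | add x y hx hy =>
    simp only [add_mul, map_add, Finsupp.add_apply, hx, hy]
    split_ifs <;> ring
  | smul c x hx =>
    simp only [smul_mul_assoc, map_smul, Finsupp.smul_apply, hx, smul_eq_mul]
    split_ifs <;> ring
  | mem m =>
    obtain ⟨k, l⟩ := m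
    rw [pbw_apply, mul_assoc, A_pow_mul_B, mul_add, mul_smul_comm, mul_smul_comm, ← mul_assoc,
      ← pow_succ, map_add, map_smul, map_smul]
    simp only [pbw_repr_monomial, Finsupp.add_apply, Finsupp.smul_apply, Finsupp.single_apply,
      Prod.mk.injEq, smul_eq_mul]
    congr 1
    · rcases i with - | i
      · simp
      · by_cases h : k = i <;> by_cases h' : l = j <;> simp [h, h']
    · rcases l with - | l
      · simp
      · by_cases h : k = i <;> by_cases h' : l = j <;> simp [h, h']

theorem pbw_repr_B_mul (z : QHeisenberg K q) (i j : ℕ) :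
    (pbw q).repr (B q * z) (i, j) = if i = 0 then 0 else (pbw q).repr z (i - 1, j) := by
  induction z using pbw_induction with
  | zero => simp
  | add x y hx hy =>
    simp only [mul_add, map_add, Finsupp.add_apply, hx, hy]
    split_ifs <;> simp
  | smul c x hx =>
    simp only [mul_smul_comm, map_smul, Finsupp.smul_apply, hx, smul_eq_mul]
    split_ifs <;> simp
  | mem m =>
    rw [pbw_apply, ← mul_assoc, ← pow_succ', pbw_repr_monomial, pbw_repr_monomial]
    rcases i with - | i <;> simp [Finsupp.single_apply, Prod.ext_iff]

theorem pbw_repr_mul_A (z : QHeisenberg K q) (i j : ℕ) :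
    (pbw q).repr (z * A q) (i, j) = if j = 0 then 0 else (pbw q).repr z (i, j - 1) := by
  induction z using pbw_induction with
  | zero => simp
  | add x y hx hy =>
    simp only [add_mul, map_add, Finsupp.add_apply, hx, hy]
    split_ifs <;> simp
  | smul c x hx =>
    simp only [smul_mul_assoc, map_smul, Finsupp.smul_apply, hx, smul_eq_mul]
    split_ifs <;> simp
  | mem m =>
    rw [pbw_apply, mul_assoc, ← pow_succ, pbw_repr_monomial, pbw_repr_monomial]
    rcases j with - | j <;> simp [Finsupp.single_apply, Prod.ext_iff]

/-- Moving an `A` past a `B` either keeps both letters or deletes one of each; `r` counts the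
deletions. -/
theorem pbw_repr_A_pow_mul_support (j k l : ℕ) (m : ℕ × ℕ)
    (hm : (pbw q).repr (A q ^ j * pbw q (k, l)) m ≠ 0) : ∃ r, m + (r, r) = (k, l + j) := by
  induction j generalizing m with
  | zero =>
    rw [pow_zero, one_mul, Module.Basis.repr_self] at hm
    exact ⟨0, (add_zero m).trans (Finsupp.single_apply_ne_zero.1 hm).1⟩
  | succ j ih =>
    obtain ⟨a, b⟩ := m
    rw [pow_succ', mul_assoc, pbw_repr_A_mul] at hm
    by_cases h : (pbw q).repr (A q ^ j * pbw q (k, l)) (a + 1, b) = 0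
    · rcases b with - | b
      · simp [h] at hm
      · obtain ⟨r, hr⟩ := ih (a, b) (by rintro h'; simp [h, h'] at hm)
        simp only [Prod.mk_add_mk, Prod.mk.injEq] at hr
        exact ⟨r, by simp only [Prod.mk_add_mk, Prod.mk.injEq]; omega⟩
    · obtain ⟨r, hr⟩ := ih (a + 1, b) h
      simp only [Prod.mk_add_mk, Prod.mk.injEq] at hr
      exact ⟨r + 1, by simp only [Prod.mk_add_mk, Prod.mk.injEq]; omega⟩

theorem pbw_repr_A_pow_mul_top (j k l : ℕ) :
    (pbw q).repr (A q ^ j * pbw q (k, l)) (k, l + j) = q ^ (j * k) := by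
  induction j with
  | zero => simp
  | succ j ih =>
    have h : (pbw q).repr (A q ^ j * pbw q (k, l)) (k + 1, l + (j + 1)) = 0 := by
      by_contra h
      obtain ⟨r, hr⟩ := pbw_repr_A_pow_mul_support j k l _ h
      simp only [Prod.mk_add_mk, Prod.mk.injEq] at hr
      omega
    rw [pow_succ', mul_assoc, pbw_repr_A_mul, h, if_neg (by omega), ← add_assoc,
      Nat.add_sub_cancel, ih]
    ring

/-- For `q = 1`, one deletion pairs any of the `j` letters `A` with any of the `k` letters `B`. -/
theorem pbw_one_repr_A_pow_mul_second (j k l a b : ℕ) (ha : a + 1 = k) (hb : b + 1 = l + j) :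
    (pbw (1 : K)).repr (A (1 : K) ^ j * pbw 1 (k, l)) (a, b) = j * k := by
  induction j generalizing b with
  | zero =>
    rw [pow_zero, one_mul, Module.Basis.repr_self, Finsupp.single_apply, if_neg]
    · simp
    · simp only [Prod.mk.injEq]; omega
  | succ j ih =>
    have hb' : b = l + j := by omega
    rw [pow_succ', mul_assoc, pbw_repr_A_mul, ha, hb', pbw_repr_A_pow_mul_top]
    rcases hlj : l + j with - | c
    · obtain rfl : j = 0 := by omega
      simp [qNumber]
    · rw [if_neg (by omega), ih _ (by omega)]
      simp [qNumber, add_mul]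

theorem pbw_mul_eq (m : ℕ × ℕ) (z : QHeisenberg K q) :
    pbw q m * z = B q ^ m.1 * (A q ^ m.2 * z) := by
  rw [pbw_apply, mul_assoc]

theorem pbw_repr_B_pow_mul (z : QHeisenberg K q) (n i j : ℕ) :
    (pbw q).repr (B q ^ n * z) (i, j) = if i < n then 0 else (pbw q).repr z (i - n, j) := by
  induction n generalizing i with
  | zero => simp
  | succ n ih =>
    rw [pow_succ', mul_assoc, pbw_repr_B_mul]
    rcases i with - | i
    · simp
    · simp [ih]

theorem pbw_mul_support {m m' κ : ℕ × ℕ} (h : (pbw q).repr (pbw q m * pbw q m') κ ≠ 0) :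
    ∃ r, m + m' = κ + (r, r) := by
  obtain ⟨i, j⟩ := κ
  rw [pbw_mul_eq, pbw_repr_B_pow_mul] at h
  split_ifs at h with hi
  · exact absurd rfl h
  · obtain ⟨r, hr⟩ := pbw_repr_A_pow_mul_support _ _ _ _ h
    simp only [Prod.mk_add_mk, Prod.mk.injEq] at hr
    exact ⟨r, by ext <;> simp <;> omega⟩

theorem pbw_mul_top (m m' : ℕ × ℕ) :
    (pbw q).repr (pbw q m * pbw q m') (m + m') = q ^ (m.2 * m'.1) := by
  rw [pbw_mul_eq, Prod.add_def, pbw_repr_B_pow_mul, if_neg (by omega), Nat.add_sub_cancel_left,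
    add_comm m.2, pbw_repr_A_pow_mul_top]

theorem pbw_one_mul_second {m m' κ : ℕ × ℕ} (h : m + m' = κ + (1, 1)) :
    (pbw (1 : K)).repr (pbw 1 m * pbw 1 m') κ = m.2 * m'.1 := by
  obtain ⟨i, j⟩ := κ
  obtain ⟨k, l⟩ := m'
  obtain ⟨u, v⟩ := m
  simp only [Prod.mk_add_mk, Prod.mk.injEq] at h
  rw [pbw_mul_eq, pbw_repr_B_pow_mul]
  split_ifs with hi
  · obtain rfl : k = 0 := by simp only at hi; omega
    simp
  · rw [pbw_one_repr_A_pow_mul_second] <;> simp only at * <;> omega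

/-! ### Leading exponents and commuting elements -/

/-- `μ` is the lexicographically largest exponent occurring in `z`. -/
def IsLeadingExponent (z : QHeisenberg K q) (μ : ℕ × ℕ) : Prop :=
  (pbw q).repr z μ ≠ 0 ∧
    ∀ m, (pbw q).repr z m ≠ 0 → m.1 < μ.1 ∨ m.1 = μ.1 ∧ m.2 ≤ μ.2

theorem exists_isLeadingExponent {z : QHeisenberg K q} (hz : z ≠ 0) :
    ∃ μ, IsLeadingExponent z μ := by
  have hs : ((pbw q).repr z).support.Nonempty := by
    rw [Finsupp.support_nonempty_iff]
    simpa using hz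
  obtain ⟨μ, hμ, hmax⟩ := Finset.exists_max_image _ toLex hs
  refine ⟨μ, by simpa using hμ, fun m hm => ?_⟩
  have h := hmax m (by simpa using hm)
  rw [Prod.Lex.le_iff] at h
  exact h

/-- Lexicographic maximality gives `m + m' ≤ μ + ν`, so a shift by `(r, r)` forces `r = 0`, `m = μ`
and `m' = ν`: a single term survives. -/
theorem bilin_eq_of_isLeadingExponent {P Q : QHeisenberg K q} {μ ν : ℕ × ℕ}
    (hP : IsLeadingExponent P μ) (hQ : IsLeadingExponent Q ν)
    (β : QHeisenberg K q →ₗ[K] QHeisenberg K q →ₗ[K] K)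
    (hβ : ∀ m m', β (pbw q m) (pbw q m') ≠ 0 → ∃ r, m + m' = μ + ν + (r, r)) :
    β P Q = (pbw q).repr P μ * ((pbw q).repr Q ν * β (pbw q μ) (pbw q ν)) := by
  rw [← LinearMap.sum_repr_mul_repr_mul (pbw q) (pbw q) P Q]
  have key : ∀ m m', (pbw q).repr P m ≠ 0 → (pbw q).repr Q m' ≠ 0 →
      β (pbw q m) (pbw q m') ≠ 0 → m = μ ∧ m' = ν := by
    intro m m' hm hm' h
    obtain ⟨r, hr⟩ := hβ m m' h
    have h1 := hP.2 m hm
    have h2 := hQ.2 m' hm'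
    simp only [Prod.ext_iff, Prod.fst_add, Prod.snd_add] at hr ⊢
    omega
  rw [Finsupp.sum, Finset.sum_eq_single μ, Finsupp.sum, Finset.sum_eq_single ν]
  · simp
  · intro m' hm' hne
    by_contra h
    simp only [smul_eq_mul, mul_eq_zero, not_or] at h
    exact hne (key _ _ h.1 h.2.1 h.2.2).2
  · intro h; simp [Finsupp.notMem_support_iff.1 h]
  · intro m hm hne
    refine Finset.sum_eq_zero fun m' _ => ?_
    by_contra h
    simp only [smul_eq_mul, mul_eq_zero, not_or] at h
    exact hne (key _ _ h.1 h.2.1 h.2.2).1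
  · intro h; simp [Finsupp.notMem_support_iff.1 h]

theorem repr_mul_of_isLeadingExponent {P Q : QHeisenberg K q} {μ ν : ℕ × ℕ}
    (hP : IsLeadingExponent P μ) (hQ : IsLeadingExponent Q ν) :
    (pbw q).repr (P * Q) (μ + ν) =
      (pbw q).repr P μ * ((pbw q).repr Q ν * q ^ (μ.2 * ν.1)) := by
  rw [← pbw_mul_top]
  exact bilin_eq_of_isLeadingExponent hP hQ
    ((LinearMap.mul K (QHeisenberg K q)).compr₂ ((pbw q).coord (μ + ν)))
    fun m m' h => pbw_mul_support h

theorem noZeroDivisors (hq : q ≠ 0) : NoZeroDivisors (QHeisenberg K q) where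
  eq_zero_or_eq_zero_of_mul_eq_zero {P Q} h := by
    by_contra! hne
    obtain ⟨μ, hμ⟩ := exists_isLeadingExponent hne.1
    obtain ⟨ν, hν⟩ := exists_isLeadingExponent hne.2
    have := repr_mul_of_isLeadingExponent hμ hν
    rw [h] at this
    simp [hμ.1, hν.1, hq] at this

theorem repr_commutator_of_isLeadingExponent {P Q : QHeisenberg K 1} {μ ν κ : ℕ × ℕ}
    (hP : IsLeadingExponent P μ) (hQ : IsLeadingExponent Q ν) (h : μ + ν = κ + (1, 1)) :
    (pbw 1).repr (P * Q) κ - (pbw 1).repr (Q * P) κ =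
      (pbw 1).repr P μ * ((pbw 1).repr Q ν * (μ.2 * ν.1 - ν.2 * μ.1)) := by
  rw [← pbw_one_mul_second h, ← pbw_one_mul_second ((add_comm ν μ).trans h)]
  refine bilin_eq_of_isLeadingExponent hP hQ
    ((LinearMap.mul K (QHeisenberg K 1)).compr₂ ((pbw 1).coord κ) -
      (LinearMap.mul K (QHeisenberg K 1)).flip.compr₂ ((pbw 1).coord κ)) fun m m' hm => ?_
  change (pbw (1 : K)).repr (pbw 1 m * pbw 1 m') κ -
    (pbw (1 : K)).repr (pbw 1 m' * pbw 1 m) κ ≠ 0 at hm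
  have hr : ∃ r, m + m' = κ + (r, r) := by
    by_contra h0
    apply hm
    rw [not_not.1 (mt pbw_mul_support h0),
      not_not.1 (mt pbw_mul_support (add_comm m m' ▸ h0)), sub_zero]
  obtain ⟨r, hr⟩ := hr
  -- For `r = 0` the coefficient is the difference of two top coefficients, both equal to `1` since
  -- `q = 1`.
  rcases r with - | r
  · exfalso
    apply hm
    have hκ : κ = m + m' := by rw [hr]; simp
    rw [hκ, pbw_mul_top, add_comm m, pbw_mul_top]
    simp
  · refine ⟨r, ?_⟩
    rw [hr, h]
    ext <;> simp <;> omega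

theorem ray_of_commute (hq : q ≠ 0) (ho : order q = 0) {P Q : QHeisenberg K q}
    (h : Commute P Q) {μ ν : ℕ × ℕ} (hP : IsLeadingExponent P μ) (hQ : IsLeadingExponent Q ν) :
    μ.2 * ν.1 = ν.2 * μ.1 := by
  by_cases h1 : q = 1
  · subst h1
    rw [order, if_pos rfl] at ho
    have : CharZero K := (CharP.ringChar_zero_iff_CharZero K).1 ho
    -- If either coordinate of `μ + ν` is zero, there is no exponent one diagonal step below, but
    -- the claim is trivial.
    rcases Nat.eq_zero_or_pos (μ.1 + ν.1) with h0 | h0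
    · rw [(add_eq_zero.1 h0).1, (add_eq_zero.1 h0).2, mul_zero, mul_zero]
    rcases Nat.eq_zero_or_pos (μ.2 + ν.2) with h0' | h0'
    · rw [(add_eq_zero.1 h0').1, (add_eq_zero.1 h0').2, zero_mul, zero_mul]
    have hκ : μ + ν = (μ.1 + ν.1 - 1, μ.2 + ν.2 - 1) + (1, 1) := by
      ext <;> simp <;> omega
    have key := repr_commutator_of_isLeadingExponent hP hQ hκ
    rw [h.eq, sub_self] at key
    have := (mul_eq_zero.1 ((mul_eq_zero.1 key.symm).resolve_left hP.1)).resolve_left hQ.1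
    exact_mod_cast sub_eq_zero.1 this
  · rw [order, if_neg h1] at ho
    have h2 := repr_mul_of_isLeadingExponent hP hQ
    rw [h.eq, add_comm μ, repr_mul_of_isLeadingExponent hQ hP, mul_left_comm] at h2
    have h3 := mul_left_cancel₀ hQ.1 (mul_left_cancel₀ hP.1 h2)
    have h4 : Units.mk0 q hq ^ (ν.2 * μ.1) = Units.mk0 q hq ^ (μ.2 * ν.1) := by
      ext; simpa using h3
    rw [pow_inj_iff_of_orderOf_eq_zero (by rw [← orderOf_units]; exact ho)] at h4
    exact h4.symm

/-! ### Dimension count in free type -/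

/-- The elements of total degree at most `n`. -/
noncomputable def degreeLE (q : K) (n : ℕ) : Submodule K (QHeisenberg K q) :=
  (Finsupp.supported K K {m : ℕ × ℕ | m.1 + m.2 ≤ n}).comap (pbw q).repr.toLinearMap

theorem mem_degreeLE {n : ℕ} {z : QHeisenberg K q} :
    z ∈ degreeLE q n ↔ ∀ m, (pbw q).repr z m ≠ 0 → m.1 + m.2 ≤ n := by
  rw [degreeLE, Submodule.mem_comap, Finsupp.mem_supported']
  exact forall_congr' fun m => not_imp_comm

theorem degreeLE_mono {a b : ℕ} (h : a ≤ b) : degreeLE q a ≤ degreeLE q b :=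
  fun _ hz => mem_degreeLE.2 fun m hm => (mem_degreeLE.1 hz m hm).trans h

theorem exists_mem_degreeLE (z : QHeisenberg K q) : ∃ n, z ∈ degreeLE q n := by
  refine ⟨((pbw q).repr z).support.sup fun m => m.1 + m.2, mem_degreeLE.2 fun m hm => ?_⟩
  exact Finset.le_sup (f := fun m : ℕ × ℕ => m.1 + m.2) (Finsupp.mem_support_iff.2 hm)

theorem one_mem_degreeLE (n : ℕ) : (1 : QHeisenberg K q) ∈ degreeLE q n := by
  refine mem_degreeLE.2 fun m hm => ?_
  have h1 : (pbw q).repr 1 = Finsupp.single (0, 0) 1 := by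
    rw [← pbw_repr_monomial q]; simp
  rw [h1] at hm
  simp [(Finsupp.single_apply_ne_zero.1 hm).1]

theorem mul_mem_degreeLE {a b : ℕ} {x y : QHeisenberg K q} (hx : x ∈ degreeLE q a)
    (hy : y ∈ degreeLE q b) : x * y ∈ degreeLE q (a + b) := by
  refine mem_degreeLE.2 fun κ hκ => ?_
  have hβ : (pbw q).repr (x * y) κ =
      (LinearMap.mul K (QHeisenberg K q)).compr₂ ((pbw q).coord κ) x y := rfl
  rw [hβ, ← LinearMap.sum_repr_mul_repr_mul (pbw q) (pbw q)] at hκ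
  obtain ⟨m, -, hm⟩ := Finset.exists_ne_zero_of_sum_ne_zero hκ
  obtain ⟨m', -, hm'⟩ := Finset.exists_ne_zero_of_sum_ne_zero hm
  simp only [smul_eq_mul, mul_ne_zero_iff] at hm'
  obtain ⟨r, hr⟩ := pbw_mul_support hm'.2.2
  have h1 := mem_degreeLE.1 hx m hm'.1
  have h2 := mem_degreeLE.1 hy m' hm'.2.1
  simp only [Prod.ext_iff, Prod.fst_add, Prod.snd_add] at hr
  omega

theorem pow_mem_degreeLE {d : ℕ} {x : QHeisenberg K q} (hx : x ∈ degreeLE q d) (n : ℕ) :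
    x ^ n ∈ degreeLE q (n * d) := by
  induction n with
  | zero => simpa using one_mem_degreeLE 0
  | succ n ih => rw [pow_succ, add_mul, one_mul]; exact mul_mem_degreeLE ih hx

/-- The points of total degree at most `n` on the ray through `μ`. -/
def rayPoints (μ : ℕ × ℕ) (n : ℕ) : Finset (ℕ × ℕ) :=
  (Finset.range (n + 1) ×ˢ Finset.range (n + 1)).filter
    fun m => m.1 + m.2 ≤ n ∧ μ.2 * m.1 = m.2 * μ.1

/-- A point on the ray is determined by its total degree, because `(μ.1 + μ.2) * m.1 = μ.1 * (m.1 +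
m.2)`. -/
theorem card_rayPoints_le {μ : ℕ × ℕ} (hμ : μ ≠ 0) (n : ℕ) : (rayPoints μ n).card ≤ n + 1 := by
  rw [← Finset.card_range (n + 1)]
  refine Finset.card_le_card_of_injOn (fun m => m.1 + m.2) (fun m hm => ?_) ?_
  · simp only [rayPoints, Finset.coe_filter, Set.mem_ofPred_eq] at hm
    simp only [Finset.coe_range, Set.mem_Iio]
    omega
  · intro m hm m' hm' h
    simp only [rayPoints, Finset.coe_filter, Set.mem_ofPred_eq] at hm hm' h
    have hpos : 0 < μ.1 + μ.2 := by
      by_contra h0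
      exact hμ (Prod.ext (by simp; omega) (by simp; omega))
    have e1 : (μ.1 + μ.2) * m.1 = (μ.1 + μ.2) * m'.1 := by
      calc (μ.1 + μ.2) * m.1 = μ.1 * (m.1 + m.2) := by linarith [hm.2.2]
        _ = μ.1 * (m'.1 + m'.2) := by rw [h]
        _ = (μ.1 + μ.2) * m'.1 := by linarith [hm'.2.2]
    have e2 := Nat.eq_of_mul_eq_mul_left hpos e1
    exact Prod.ext e2 (by omega)

theorem not_linearIndependent_of_commute (hq : q ≠ 0) (ho : order q = 0)
    {P Q : QHeisenberg K q} (h : Commute P Q) :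
    ∃ n, ¬ LinearIndependent K fun ij : Fin n × Fin n => P ^ (ij.1 : ℕ) * Q ^ (ij.2 : ℕ) := by
  by_cases hc : ∃ c : K, P = c • 1
  · obtain ⟨c, rfl⟩ := hc
    refine ⟨2, fun hli => ?_⟩
    -- The dependence is `P - c • 1 = 0`.
    have := Fintype.linearIndependent_iff.1 hli
      (fun ij => if ij = (1, 0) then 1 else if ij = (0, 0) then -c else 0)
      (by simp [Fintype.sum_prod_type, Fin.sum_univ_two]) (1, 0)
    simp at this
  have hP0 : P ≠ 0 := fun h0 => hc ⟨0, by simp [h0]⟩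
  obtain ⟨μ, hμ⟩ := exists_isLeadingExponent hP0
  have hμ0 : μ ≠ 0 := by
    rintro rfl
    refine hc ⟨(pbw q).repr P 0, (pbw q).repr.injective (Finsupp.ext fun m => ?_)⟩
    have h1 : (1 : QHeisenberg K q) = pbw q 0 := by simp [pbw_apply]
    rw [h1, map_smul, Module.Basis.repr_self, Finsupp.smul_single, smul_eq_mul, mul_one,
      Finsupp.single_apply]
    split_ifs with hm
    · rw [hm]
    · by_contra h0
      have := hμ.2 m h0
      refine hm (Prod.ext ?_ ?_) <;> simp at this ⊢ <;> omega
  obtain ⟨a, ha⟩ := exists_mem_degreeLE P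
  obtain ⟨b, hb⟩ := exists_mem_degreeLE Q
  set d := max a b
  have hPd : P ∈ degreeLE q d := degreeLE_mono (le_max_left a b) ha
  have hQd : Q ∈ degreeLE q d := degreeLE_mono (le_max_right a b) hb
  -- Large enough that `(N + 1) ^ 2 > 2 * N * d + 1`.
  set N := 2 * d + 1 with hN
  refine ⟨N + 1, fun hli => ?_⟩
  let T : QHeisenberg K q →ₗ[K] (rayPoints μ (2 * N * d) → K) :=
    LinearMap.pi fun m => (pbw q).coord m
  have hW : Submodule.span K (Set.range fun ij : Fin (N + 1) × Fin (N + 1) =>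
      P ^ (ij.1 : ℕ) * Q ^ (ij.2 : ℕ)) ≤
      (Subalgebra.centralizer K {P}).toSubmodule ⊓ degreeLE q (2 * N * d) := by
    rw [Submodule.span_le]
    rintro _ ⟨⟨i, j⟩, rfl⟩
    refine ⟨?_, ?_⟩
    · rw [SetLike.mem_coe, Subalgebra.mem_toSubmodule, Subalgebra.mem_centralizer_iff]
      intro x hx
      rw [Set.mem_singleton_iff.1 hx]
      exact (((Commute.refl P).pow_right _).mul_right (h.pow_right _)).eq
    · refine degreeLE_mono ?_ (mul_mem_degreeLE (pow_mem_degreeLE hPd i) (pow_mem_degreeLE hQd j))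
      rw [← add_mul]
      exact Nat.mul_le_mul_right d (by omega)
  -- A nonzero element of the span commutes with `P`, so its leading exponent lies on the ray and
  -- `T` detects it.
  have hdisj : Disjoint (Submodule.span K (Set.range fun ij : Fin (N + 1) × Fin (N + 1) =>
      P ^ (ij.1 : ℕ) * Q ^ (ij.2 : ℕ))) (LinearMap.ker T) := by
    rw [Submodule.disjoint_def]
    intro z hz hTz
    obtain ⟨hcz, hdz⟩ := hW hz
    by_contra hz0
    obtain ⟨ν, hν⟩ := exists_isLeadingExponent hz0
    have hray := ray_of_commute hq ho (Subalgebra.mem_centralizer_iff K |>.1 hcz P rfl) hμ hν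
    have hdeg := mem_degreeLE.1 hdz ν hν.1
    have hmem : ν ∈ rayPoints μ (2 * N * d) := by
      simp only [rayPoints, Finset.mem_filter, Finset.mem_product, Finset.mem_range]
      omega
    exact hν.1 (congrFun (LinearMap.mem_ker.1 hTz) ⟨ν, hmem⟩)
  have hcard := (hli.map hdisj).fintype_card_le_finrank
  rw [Module.finrank_fintype_fun_eq_card, Fintype.card_coe, Fintype.card_prod,
    Fintype.card_fin] at hcard
  have := hcard.trans (card_rayPoints_le hμ0 _)
  rw [hN] at this
  nlinarith

/-! ### From linear dependence to a polynomial -/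

theorem exists_evalCentral_eq_zero {R : Type*} [Ring R] [Algebra K R] {P Q : R} {n : ℕ}
    (h : ¬ LinearIndependent (Subalgebra.center K R)
      fun ij : Fin n × Fin n => P ^ (ij.1 : ℕ) * Q ^ (ij.2 : ℕ)) :
    ∃ F : MvPolynomial (Fin 2) (Subalgebra.center K R), F ≠ 0 ∧ evalCentral F P Q = 0 := by
  obtain ⟨g, hg, ij, hij⟩ := Fintype.not_linearIndependent_iff.1 h
  let v : (Fin 2 →₀ ℕ) → R := fun m => P ^ m 0 * Q ^ m 1
  let e : Fin n × Fin n → (Fin 2 →₀ ℕ) := fun ij =>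
    Finsupp.equivFunOnFinite.symm ![(ij.1 : ℕ), (ij.2 : ℕ)]
  have he : Function.Injective e := by
    intro x y hxy
    have h0 := DFunLike.congr_fun hxy 0
    have h1 := DFunLike.congr_fun hxy 1
    simp only [e, Finsupp.equivFunOnFinite_symm_apply_apply] at h0 h1
    exact Prod.ext (Fin.ext h0) (Fin.ext h1)
  let b := MvPolynomial.basisMonomials (Fin 2) (Subalgebra.center K R)
  have heval : ∀ F, evalCentral F P Q = b.constr (Subalgebra.center K R) v F := by
    intro F
    conv_rhs => rw [← MvPolynomial.support_sum_monomial_coeff F]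
    rw [map_sum]
    refine Finset.sum_congr rfl fun m _ => ?_
    have : MvPolynomial.monomial m (MvPolynomial.coeff m F) = MvPolynomial.coeff m F • b m := by
      simp [b, MvPolynomial.smul_monomial]
    rw [this, map_smul, Module.Basis.constr_basis]
    rfl
  refine ⟨∑ x, g x • b (e x), fun h0 => ?_, ?_⟩
  · exact hij (Fintype.linearIndependent_iff.1 (b.linearIndependent.comp e he) g h0 ij)
  · rw [heval, map_sum, ← hg]
    refine Finset.sum_congr rfl fun x _ => ?_
    rw [map_smul, Module.Basis.constr_basis]
    rfl

/-! ### Center and spanning set in torsion type -/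

theorem qNumber_eq_zero_iff {p : ℕ} (ho : order q = p) (n : ℕ) :
    qNumber q n = 0 ↔ p ∣ n := by
  by_cases h1 : q = 1
  · subst h1
    rw [order, if_pos rfl] at ho
    rw [← ho, ← ringChar.spec]
    simp [qNumber]
  · rw [order, if_neg h1] at ho
    rw [← ho, orderOf_dvd_iff_pow_eq_one, ← sub_eq_zero (b := (1 : K)), ← mul_qNumber,
      mul_eq_zero, or_iff_right (sub_ne_zero.2 h1)]

theorem pow_order_eq_one {p : ℕ} (ho : order q = p) : q ^ p = 1 := by
  have h := mul_qNumber q p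
  rw [(qNumber_eq_zero_iff ho p).2 dvd_rfl, mul_zero] at h
  exact (sub_eq_zero.1 h.symm)

theorem mem_center_of_commute {z : QHeisenberg K q} (hA : A q * z = z * A q)
    (hB : B q * z = z * B q) : z ∈ Subalgebra.center K (QHeisenberg K q) := by
  have htop : (Subalgebra.centralizer K {z}).toSubmodule = ⊤ := by
    refine submodule_eq_top ?_ ?_ ?_
    · exact one_mem (Subalgebra.centralizer K {z})
    · refine fun x hx => mul_mem (S := Subalgebra K (QHeisenberg K q)) ?_ hx
      rw [Subalgebra.mem_centralizer_iff]
      rintro _ rfl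
      exact hA.symm
    · refine fun x hx => mul_mem (S := Subalgebra K (QHeisenberg K q)) ?_ hx
      rw [Subalgebra.mem_centralizer_iff]
      rintro _ rfl
      exact hB.symm
  rw [Subalgebra.mem_center_iff]
  intro x
  have hx : x ∈ (Subalgebra.centralizer K {z}).toSubmodule := htop ▸ Submodule.mem_top
  exact ((Subalgebra.mem_centralizer_iff K).1 hx z rfl).symm

theorem A_pow_mem_center {p : ℕ} (ho : order q = p) :
    A q ^ p ∈ Subalgebra.center K (QHeisenberg K q) := by
  refine mem_center_of_commute ((Commute.refl _).pow_right p).eq ?_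
  rw [A_pow_mul_B, pow_order_eq_one ho, (qNumber_eq_zero_iff ho p).2 dvd_rfl]
  simp

theorem B_pow_mem_center {p : ℕ} (ho : order q = p) :
    B q ^ p ∈ Subalgebra.center K (QHeisenberg K q) := by
  refine mem_center_of_commute ?_ ((Commute.refl _).pow_right p).eq
  rw [A_mul_B_pow, pow_order_eq_one ho, (qNumber_eq_zero_iff ho p).2 dvd_rfl]
  simp

/-- Comparing coordinates of `A z = z A` at `(i, j + 1)` expresses the quantity at `(i + 1, j + 1)`
as `1 - q` times that at `(i, j)`, so vanishing propagates along diagonals. -/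
theorem qNumber_mul_repr_eq_zero_of_commute_A {z : QHeisenberg K q} (h : A q * z = z * A q)
    (i j : ℕ) : qNumber q i * (pbw q).repr z (i, j) = 0 := by
  induction i generalizing j with
  | zero => simp
  | succ i ih =>
    have key := pbw_repr_A_mul z i j
    rw [h, pbw_repr_mul_A] at key
    rcases j with - | j
    · simpa using key.symm
    · have hi := ih j
      have hq := mul_qNumber q i
      simp only [Nat.add_eq_zero_iff, one_ne_zero, and_false, if_false, Nat.add_sub_cancel] at key
      linear_combination -key - (q - 1) * hi + hq * (pbw q).repr z (i, j)

theorem qNumber_mul_repr_eq_zero_of_commute_B {z : QHeisenberg K q} (h : B q * z = z * B q)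
    (i j : ℕ) : qNumber q j * (pbw q).repr z (i, j) = 0 := by
  induction j generalizing i with
  | zero => simp
  | succ j ih =>
    have key := pbw_repr_mul_B z i j
    rw [← h, pbw_repr_B_mul] at key
    rcases i with - | i
    · simpa using key.symm
    · have hj := ih i
      have hq := mul_qNumber q j
      simp only [Nat.add_eq_zero_iff, one_ne_zero, and_false, if_false, Nat.add_sub_cancel] at key
      linear_combination -key - (q - 1) * hj + hq * (pbw q).repr z (i, j)

theorem center_eq_adjoin {p : ℕ} (ho : order q = p) :
    Subalgebra.center K (QHeisenberg K q) = Algebra.adjoin K {A q ^ p, B q ^ p} := by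
  apply le_antisymm
  · intro z hz
    rw [Subalgebra.mem_center_iff] at hz
    rw [← (pbw q).linearCombination_repr z, Finsupp.linearCombination_apply]
    refine sum_mem fun m hm => Subalgebra.smul_mem _ ?_ _
    rw [Finsupp.mem_support_iff] at hm
    obtain ⟨i, hi⟩ := (qNumber_eq_zero_iff ho m.1).1 ((mul_eq_zero.1
      (qNumber_mul_repr_eq_zero_of_commute_A (hz (A q)) m.1 m.2)).resolve_right hm)
    obtain ⟨j, hj⟩ := (qNumber_eq_zero_iff ho m.2).1 ((mul_eq_zero.1
      (qNumber_mul_repr_eq_zero_of_commute_B (hz (B q)) m.1 m.2)).resolve_right hm)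
    rw [pbw_apply, hi, hj, pow_mul, pow_mul]
    exact mul_mem (pow_mem (Algebra.subset_adjoin (by simp)) _)
      (pow_mem (Algebra.subset_adjoin (by simp)) _)
  · rw [Algebra.adjoin_le_iff]
    rintro _ (rfl | rfl)
    · exact A_pow_mem_center ho
    · exact B_pow_mem_center ho

instance nontrivial (q : K) : Nontrivial (QHeisenberg K q) :=
  ⟨⟨pbw q 0, 0, (pbw q).ne_zero 0⟩⟩

theorem isDomain_center (hq : q ≠ 0) : IsDomain (Subalgebra.center K (QHeisenberg K q)) := by
  have := noZeroDivisors hq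
  have : IsDomain (QHeisenberg K q) := NoZeroDivisors.to_isDomain _
  infer_instance

theorem injective_monomials (q : K) (p : ℕ) : Function.Injective fun ij : Fin p × Fin p =>
    B q ^ (ij.1 : ℕ) * A q ^ (ij.2 : ℕ) := by
  intro x y h
  have h' : pbw q (x.1, x.2) = pbw q (y.1, y.2) := by simpa [pbw_apply] using h
  have := (pbw q).injective h'
  simp only [Prod.mk.injEq, Fin.val_inj] at this
  exact Prod.ext this.1 this.2

theorem ncard_monomials (q : K) (p : ℕ) : (Set.range fun ij : Fin p × Fin p =>
    B q ^ (ij.1 : ℕ) * A q ^ (ij.2 : ℕ)).ncard = p ^ 2 := by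
  rw [← Set.image_univ, Set.ncard_image_of_injective _ (injective_monomials q p),
    Set.ncard_univ, Nat.card_prod, Nat.card_fin, sq]

theorem span_center_monomials {p : ℕ} (hp : 0 < p) (ho : order q = p) :
    Submodule.span (Subalgebra.center K (QHeisenberg K q))
      (Set.range fun ij : Fin p × Fin p => B q ^ (ij.1 : ℕ) * A q ^ (ij.2 : ℕ)) = ⊤ := by
  rw [eq_top_iff]
  intro z _
  induction z using pbw_induction with
  | zero => exact zero_mem _
  | add x y hx hy => exact add_mem (hx trivial) (hy trivial)
  | smul c x hx =>
    have h := Submodule.smul_mem _ (algebraMap K (Subalgebra.center K (QHeisenberg K q)) c)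
      (hx trivial)
    rwa [algebraMap_smul] at h
  | mem m =>
    have hA : A q ^ (p * (m.2 / p)) ∈ Subalgebra.center K (QHeisenberg K q) := by
      rw [pow_mul]; exact pow_mem (A_pow_mem_center ho) _
    have hB : B q ^ (p * (m.1 / p)) ∈ Subalgebra.center K (QHeisenberg K q) := by
      rw [pow_mul]; exact pow_mem (B_pow_mem_center ho) _
    -- Divide both exponents by `p`: the multiples of `p` go into a central factor.
    have h : pbw q m = (⟨_, hB⟩ * ⟨_, hA⟩ : Subalgebra.center K (QHeisenberg K q)) •
        (B q ^ (m.1 % p) * A q ^ (m.2 % p)) := by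
      change _ = B q ^ (p * (m.1 / p)) * A q ^ (p * (m.2 / p)) *
        (B q ^ (m.1 % p) * A q ^ (m.2 % p))
      rw [mul_assoc, ← mul_assoc (A q ^ _), ← Subalgebra.mem_center_iff.1 hA, pbw_apply,
        mul_assoc, ← mul_assoc (B q ^ _) (B q ^ _), ← pow_add, ← pow_add, Nat.div_add_mod,
        Nat.div_add_mod]
    rw [h]
    exact Submodule.smul_mem _ _
      (Submodule.subset_span ⟨(⟨_, Nat.mod_lt _ hp⟩, ⟨_, Nat.mod_lt _ hp⟩), rfl⟩)

theorem not_linearIndependent_of_torsion {p : ℕ} (hp : 0 < p) (ho : order q = p)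
    (α β : QHeisenberg K q) :
    ¬ LinearIndependent (Subalgebra.center K (QHeisenberg K q))
      fun ij : Fin (p + 1) × Fin (p + 1) => α ^ (ij.1 : ℕ) * β ^ (ij.2 : ℕ) := by
  intro hli
  have h := linearIndependent_le_span_finset _ hli
    (Set.finite_range fun ij : Fin p × Fin p =>
      B q ^ (ij.1 : ℕ) * A q ^ (ij.2 : ℕ)).toFinset
    (by rw [Set.Finite.coe_toFinset]; exact span_center_monomials hp ho)
  rw [← Set.ncard_eq_toFinset_card _ (Set.finite_range _), ncard_monomials, Cardinal.mk_fintype, Nat.cast_le,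
    Fintype.card_prod, Fintype.card_fin] at h
  nlinarith

end QHeisenberg

theorem mainTheorem3 (K : Type*) [Field K] (q : K) (hq : q ≠ 0) :
    (∀ P Q : QHeisenberg K q, Commute P Q →
      ∃ F : MvPolynomial (Fin 2) (Subalgebra.center K (QHeisenberg K q)),
        F ≠ 0 ∧ evalCentral F P Q = 0) ∧
    (∀ p : ℕ, 0 < p → QHeisenberg.order q = p →
      Subalgebra.center K (QHeisenberg K q) =
        Algebra.adjoin K {QHeisenberg.A q ^ p, QHeisenberg.B q ^ p} ∧
      IsDomain (Subalgebra.center K (QHeisenberg K q)) ∧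
      (Set.range fun ij : Fin p × Fin p =>
        QHeisenberg.B q ^ (ij.1 : ℕ) * QHeisenberg.A q ^ (ij.2 : ℕ)).ncard = p ^ 2 ∧
      Submodule.span (Subalgebra.center K (QHeisenberg K q))
        (Set.range fun ij : Fin p × Fin p =>
          QHeisenberg.B q ^ (ij.1 : ℕ) * QHeisenberg.A q ^ (ij.2 : ℕ)) = ⊤ ∧
      ∀ α β : QHeisenberg K q,
        ¬ LinearIndependent (Subalgebra.center K (QHeisenberg K q))
          fun ij : Fin (p + 1) × Fin (p + 1) => α ^ (ij.1 : ℕ) * β ^ (ij.2 : ℕ)) := by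
  constructor
  · intro P Q h
    rcases Nat.eq_zero_or_pos (QHeisenberg.order q) with ho | ho
    · obtain ⟨n, hn⟩ := QHeisenberg.not_linearIndependent_of_commute hq ho h
      refine QHeisenberg.exists_evalCentral_eq_zero (n := n) fun hli => hn ?_
      -- Independence over the center would imply independence over `K`.
      refine hli.restrict_scalars ?_
      rw [← Algebra.algebraMap_eq_smul_one']
      exact FaithfulSMul.algebraMap_injective _ _
    · exact QHeisenberg.exists_evalCentral_eq_zero
        (QHeisenberg.not_linearIndependent_of_torsion ho rfl P Q)
  · intro p hp ho
    exact ⟨QHeisenberg.center_eq_adjoin ho, QHeisenberg.isDomain_center hq,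
      QHeisenberg.ncard_monomials q p, QHeisenberg.span_center_monomials hp ho,
      QHeisenberg.not_linearIndependent_of_torsion hp ho⟩
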